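/- Let $X$ be a set. A *graph* (in the sense of Serre) has vertices, directed edges $e$ with initial vertex $\alpha(e)$ and terminal vertex $\omega(e)$, and an inverse edge $e^{-1}\neq e$ for every $e$, with $(e^{-1})^{-1}=e$, $\alpha(e^{-1})=\omega(e)$; exactly one of $e,e^{-1}$ is positively oriented. All graphs are *edge-labelled*: positive edges carry labels in $X$, the inverse of an edge labelled $x$ is labelled $x^{-1}$, and no two positive edges with the same initial vertex or with the same terminal vertex have the same label. Morphisms of graphs preserve incidence, inverses, orientation and labels; an *immersion* is a morphism that is injective on the set of edges starting at each vertex. For a graph $\Gamma$, the *free inverse category* $FIC(\Gamma)$ is the quotient of the free category on $\Gamma$ (objects: vertices, morphisms: paths) by the category congruence generated by $p\sim pp^{-1}p$ for all paths $p$ and $pp^{-1}qq^{-1}\sim qq^{-1}pp^{-1}$ for all paths $p,q$ with the same initial vertex. Write $[[p]]$ for the class of $p$. The *loop monoid* $L(\Gamma,v)=\{[[p]] : p \text{ a circuit at } v\}$ is an inverse monoid. In an inverse monoid $M$ put $a\le b$ if $a=eb$ for some idempotent $e$, and for $N\subseteq M$ put $N^\omega=\{m\in M: m\ge n \text{ for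 some } n\in N\}$; an inverse submonoid $H$ is *closed* if $H^\omega=H$. The *normalizer* of a closed inverse submonoid $H$ of $M$ is $N(H)=\{a\in M: aHa^{-1}\subseteq H,\ a^{-1}Ha\subseteq H\}$. The relation $a\,\rho_H\,c \iff (Ha)^\omega=(Hc)^\omega$ is a congruence on $N(H)$, and the quotient $N(H)/H:=N(H)/\rho_H$ is a group, the group of right $\omega$-cosets of $H$ in $N(H)$, with $(Ha)^\omega(Hb)^\omega=(Hab)^\omega$. **Theorem.** Let $f:\tilde\Gamma\to\Gamma$ be an immersion of connected graphs, let $v_0$ be a vertex of $\Gamma$ and $\tilde v_0\in f^{-1}(v_0)$, and let $H=f(L(\tilde\Gamma,\tilde v_0))=\{[[f(p)]] : p \text{ a circuit at } \tilde v_0\}$, a closed inverse submonoid of $L(\Gamma,v_0)$. Let $G(\tilde\Gamma)$ be the group, under composition, of deck transformations of $f$, i.e. of the labelled graph automorphisms $\gamma$ of $\tilde\Gamma$ with $f\circ\gamma=f$. Then $$G(\tilde\Gamma)\;\cong\; N(H,v_0)/H,$$ where $N(H,v_0)$ is the normalizer of $H$ in $L(\Gamma,v_0)$. -/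

import Mathlib

universe u v u' v' w

/-! ## Inverse monoids, closed inverse submonoids and their normalizers -/

/-- An inverse monoid: every `a` has a unique element `a⁻¹` with
`a = a a⁻¹ a` and `a⁻¹ = a⁻¹ a a⁻¹`. -/
class InverseMonoid (M : Type u) extends Monoid M, Inv M where
  mul_inv_mul : ∀ a : M, a * a⁻¹ * a = a
  inv_mul_inv : ∀ a : M, a⁻¹ * a * a⁻¹ = a⁻¹
  inv_unique : ∀ a b : M, a * b * a = a → b * a * b = b → b = a⁻¹

namespace InverseMonoid

variable {M : Type u} [InverseMonoid M]

theorem inv_inv' (a : M) : a⁻¹⁻¹ = a :=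
  (inv_unique a⁻¹ a (inv_mul_inv a) (mul_inv_mul a)).symm

theorem idem_inv {e : M} (he : e * e = e) : e⁻¹ = e :=
  (inv_unique e e (by rw [he, he]) (by rw [he, he])).symm

theorem idem_mul_idem {e f : M} (he : e * e = e) (hf : f * f = f) :
    (e * f) * (e * f) = e * f := by
  have h1 := mul_inv_mul (e * f)
  have h2 := inv_mul_inv (e * f)
  set x := (e * f)⁻¹ with hx
  have hfx : f * x * e = x := by
    apply inv_unique
    · calc e * f * (f * x * e) * (e * f) = e * (f * f) * x * (e * e) * f := by
            simp only [mul_assoc]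
        _ = e * f * x * (e * f) := by rw [he, hf]; simp only [mul_assoc]
        _ = e * f := h1
    · calc f * x * e * (e * f) * (f * x * e) = f * (x * ((e * e) * (f * f)) * x) * e := by
            simp only [mul_assoc]
        _ = f * x * e := by rw [he, hf, h2]
  have hxx : x * x = x := by
    calc x * x = (f * x * e) * (f * x * e) := by rw [hfx]
      _ = f * (x * (e * f) * x) * e := by simp only [mul_assoc]
      _ = x := by rw [h2, hfx]
  have : e * f = x := by
    have h := inv_unique x (e * f) h2 h1
    rwa [idem_inv hxx] at h
  rw [this, hxx]

theorem idem_comm {e f : M} (he : e * e = e) (hf : f * f = f) : e * f = f * e := by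
  have h1 := idem_mul_idem he hf
  have h2 := idem_mul_idem hf he
  have h3 : f * e = (e * f)⁻¹ := by
    apply inv_unique
    · calc e * f * (f * e) * (e * f) = e * (f * f) * (e * e) * f := by simp only [mul_assoc]
        _ = e * f := by rw [he, hf]; simpa only [mul_assoc] using h1
    · calc f * e * (e * f) * (f * e) = f * (e * e) * (f * f) * e := by simp only [mul_assoc]
        _ = f * e := by rw [he, hf]; simpa only [mul_assoc] using h2
  rw [h3, idem_inv h1]

theorem mul_inv_idem (a : M) : (a * a⁻¹) * (a * a⁻¹) = a * a⁻¹ := by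
  rw [← mul_assoc, mul_inv_mul]

theorem inv_mul_idem (a : M) : (a⁻¹ * a) * (a⁻¹ * a) = a⁻¹ * a := by
  rw [← mul_assoc, inv_mul_inv]

theorem mul_inv_rev' (a b : M) : (a * b)⁻¹ = b⁻¹ * a⁻¹ := by
  symm
  have hc := idem_comm (mul_inv_idem b) (inv_mul_idem a)
  apply inv_unique
  · calc a * b * (b⁻¹ * a⁻¹) * (a * b) = a * ((b * b⁻¹) * (a⁻¹ * a)) * b := by
          simp only [mul_assoc]
      _ = (a * a⁻¹ * a) * (b * b⁻¹ * b) := by rw [hc]; simp only [mul_assoc]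
      _ = a * b := by rw [mul_inv_mul, mul_inv_mul]
  · calc b⁻¹ * a⁻¹ * (a * b) * (b⁻¹ * a⁻¹) = b⁻¹ * ((a⁻¹ * a) * (b * b⁻¹)) * a⁻¹ := by
          simp only [mul_assoc]
      _ = (b⁻¹ * b * b⁻¹) * (a⁻¹ * a * a⁻¹) := by rw [← hc]; simp only [mul_assoc]
      _ = b⁻¹ * a⁻¹ := by rw [inv_mul_inv, inv_mul_inv]

/-- The natural partial order: `a ≤ b` iff `a = e b` for some idempotent `e`. -/
def NatLE (a b : M) : Prop := ∃ e : M, e * e = e ∧ a = e * b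

theorem NatLE.refl (a : M) : NatLE a a := ⟨1, by simp, by simp⟩

theorem NatLE.trans {a b c : M} (h : NatLE a b) (h' : NatLE b c) : NatLE a c := by
  obtain ⟨e, he, rfl⟩ := h
  obtain ⟨f, hf, rfl⟩ := h'
  exact ⟨e * f, idem_mul_idem he hf, by simp only [mul_assoc]⟩

theorem NatLE.mul_right {a b : M} (h : NatLE a b) (c : M) : NatLE (a * c) (b * c) := by
  obtain ⟨e, he, rfl⟩ := h
  exact ⟨e, he, by simp only [mul_assoc]⟩

theorem NatLE.mul_left {a b : M} (h : NatLE a b) (c : M) : NatLE (c * a) (c * b) := by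
  obtain ⟨e, he, rfl⟩ := h
  have hc := idem_comm he (inv_mul_idem c)
  have key : c * e = c * e * c⁻¹ * c := by
    calc c * e = (c * c⁻¹ * c) * e := by rw [mul_inv_mul]
      _ = c * ((c⁻¹ * c) * e) := by simp only [mul_assoc]
      _ = c * e * c⁻¹ * c := by rw [← hc]; simp only [mul_assoc]
  refine ⟨c * e * c⁻¹, ?_, ?_⟩
  · calc c * e * c⁻¹ * (c * e * c⁻¹) = (c * e * c⁻¹ * c) * e * c⁻¹ := by simp only [mul_assoc]
      _ = c * (e * e) * c⁻¹ := by rw [← key]; simp only [mul_assoc]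
      _ = c * e * c⁻¹ := by rw [he]
  · calc c * (e * b) = (c * e) * b := by simp only [mul_assoc]
      _ = (c * e * c⁻¹ * c) * b := congrArg (· * b) key
      _ = c * e * c⁻¹ * (c * b) := by simp only [mul_assoc]

/-- `N^ω`: all elements that lie above some element of `N` in the natural partial order. -/
def omegaClosure (N : Set M) : Set M := {m | ∃ n ∈ N, NatLE n m}

end InverseMonoid

open InverseMonoid in
/-- A closed inverse submonoid `H` of an inverse monoid: a submonoid that is stable under
inversion and satisfies `H^ω = H`. -/
structure ClosedInverseSubmonoid (M : Type u) [InverseMonoid M] extends Submonoid M where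
  inv_mem : ∀ {a : M}, a ∈ carrier → a⁻¹ ∈ carrier
  closed : omegaClosure carrier = carrier

namespace ClosedInverseSubmonoid

open InverseMonoid

variable {M : Type u} [InverseMonoid M] (H : ClosedInverseSubmonoid M)

theorem mem_of_le {a b : M} (ha : a ∈ H.toSubmonoid) (h : NatLE a b) : b ∈ H.toSubmonoid := by
  have : b ∈ omegaClosure H.carrier := ⟨a, ha, h⟩
  rw [H.closed] at this
  exact this

/-- The normalizer `N(H) = {a ∈ M : a H a⁻¹ ⊆ H and a⁻¹ H a ⊆ H}`, as a submonoid of `M`. -/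
def normalizer : Submonoid M where
  carrier := {a | (∀ h ∈ H.toSubmonoid, a * h * a⁻¹ ∈ H.toSubmonoid) ∧
    (∀ h ∈ H.toSubmonoid, a⁻¹ * h * a ∈ H.toSubmonoid)}
  one_mem' := by
    have : (1 : M)⁻¹ = 1 := idem_inv (by simp)
    constructor <;> intro h hh <;> simpa [this] using hh
  mul_mem' := by
    rintro a b ⟨ha, ha'⟩ ⟨hb, hb'⟩
    constructor
    · intro h hh
      have := ha _ (hb h hh)
      simpa only [mul_inv_rev', mul_assoc] using this
    · intro h hh
      have := hb' _ (ha' h hh)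
      simpa only [mul_inv_rev', mul_assoc] using this

theorem inv_mem_normalizer {a : M} (ha : a ∈ H.normalizer) : a⁻¹ ∈ H.normalizer := by
  refine ⟨fun h hh => ?_, fun h hh => ?_⟩
  · rw [inv_inv']; exact ha.2 h hh
  · rw [inv_inv']; exact ha.1 h hh

theorem mul_inv_mem_of_normalizer {a : M} (ha : a ∈ H.normalizer) :
    a * a⁻¹ ∈ H.toSubmonoid := by
  simpa using ha.1 1 H.one_mem

/-- The right `ω`-coset `(Ha)^ω`. -/
def rightOmegaCoset (a : M) : Set M := omegaClosure {x | ∃ h ∈ H.toSubmonoid, x = h * a}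

theorem rightOmegaCoset_subset {a c : M} (h : a * c⁻¹ ∈ H.toSubmonoid) :
    H.rightOmegaCoset a ⊆ H.rightOmegaCoset c := by
  rintro x ⟨_, ⟨k, hk, rfl⟩, hx⟩
  refine ⟨k * (a * c⁻¹) * c, ⟨_, H.mul_mem hk h, rfl⟩, NatLE.trans ?_ hx⟩
  have : NatLE (a * (c⁻¹ * c)) (a * 1) :=
    NatLE.mul_left ⟨c⁻¹ * c, inv_mul_idem c, by simp⟩ a
  simpa only [mul_assoc, mul_one] using this.mul_left k

theorem rightOmegaCoset_eq_iff {a c : M} (_ha : a * a⁻¹ ∈ H.toSubmonoid)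
    (hc : c * c⁻¹ ∈ H.toSubmonoid) :
    H.rightOmegaCoset a = H.rightOmegaCoset c ↔ a * c⁻¹ ∈ H.toSubmonoid := by
  constructor
  · intro h
    have hmem : a ∈ H.rightOmegaCoset a := ⟨a, ⟨1, H.one_mem, by simp⟩, NatLE.refl a⟩
    rw [h] at hmem
    obtain ⟨_, ⟨k, hk, rfl⟩, hx⟩ := hmem
    refine H.mem_of_le (H.mul_mem hk hc) ?_
    simpa only [mul_assoc] using hx.mul_right c⁻¹
  · intro h
    refine Set.Subset.antisymm (H.rightOmegaCoset_subset h) (H.rightOmegaCoset_subset ?_)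
    have := H.inv_mem h
    rwa [mul_inv_rev', inv_inv'] at this

/-- The congruence `ρ_H` on `N(H)`: `a ρ_H c` iff `(Ha)^ω = (Hc)^ω`. -/
def rho : Con H.normalizer where
  r a c := H.rightOmegaCoset (a : M) = H.rightOmegaCoset (c : M)
  iseqv := ⟨fun _ => rfl, fun h => h.symm, fun h h' => h.trans h'⟩
  mul' := by
    rintro ⟨a, ha⟩ ⟨c, hc⟩ ⟨b, hb⟩ ⟨d, hd⟩ h h'
    have mem := fun {x : M} (hx : x ∈ H.normalizer) => H.mul_inv_mem_of_normalizer hx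
    have h1 := (H.rightOmegaCoset_eq_iff (mem ha) (mem hc)).1 h
    have h2 := (H.rightOmegaCoset_eq_iff (mem hb) (mem hd)).1 h'
    refine (H.rightOmegaCoset_eq_iff (mem (H.normalizer.mul_mem ha hb))
      (mem (H.normalizer.mul_mem hc hd))).2 ?_
    refine H.mem_of_le (H.mul_mem (ha.1 _ h2) h1) ?_
    have : NatLE (a⁻¹ * a * c⁻¹) c⁻¹ := ⟨a⁻¹ * a, inv_mul_idem a, rfl⟩
    simpa only [mul_inv_rev', mul_assoc] using this.mul_left (a * (b * d⁻¹))

/-- `N(H)/H`: the quotient of `N(H)` by `ρ_H`, whose elements are the right `ω`-cosets of `H`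
in `N(H)`. -/
def CosetGroup : Type u := H.rho.Quotient

/-- The multiplication is `(Ha)^ω (Hb)^ω = (Hab)^ω`. -/
instance : Group H.CosetGroup :=
  { (inferInstance : Monoid H.rho.Quotient) with
    inv := Quotient.map' (s₁ := H.rho.toSetoid) (s₂ := H.rho.toSetoid)
      (fun a => ⟨(a : M)⁻¹, H.inv_mem_normalizer a.2⟩) (by
        rintro ⟨a, ha⟩ ⟨c, hc⟩ h
        have mem := fun {x : M} (hx : x ∈ H.normalizer) => H.mul_inv_mem_of_normalizer hx
        have h1 := (H.rightOmegaCoset_eq_iff (mem hc) (mem ha)).1 (Eq.symm h)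
        refine (H.rightOmegaCoset_eq_iff (mem (H.inv_mem_normalizer ha))
          (mem (H.inv_mem_normalizer hc))).2 ?_
        refine H.mem_of_le (ha.2 _ h1) ?_
        have : NatLE (a⁻¹ * a) 1 := ⟨a⁻¹ * a, inv_mul_idem a, by simp⟩
        simpa only [inv_inv', mul_assoc, mul_one] using this.mul_left (a⁻¹ * c))
    inv_mul_cancel := by
      intro x
      induction x using Quotient.inductionOn' with
      | h a =>
        obtain ⟨a, ha⟩ := a
        refine Quotient.sound' (s₁ := H.rho.toSetoid) ?_
        have mem := fun {x : M} (hx : x ∈ H.normalizer) => H.mul_inv_mem_of_normalizer hx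
        refine (H.rightOmegaCoset_eq_iff
          (mem (H.normalizer.mul_mem (H.inv_mem_normalizer ha) ha))
          (mem H.normalizer.one_mem)).2 ?_
        have h1 : (1 : M)⁻¹ = 1 := idem_inv (by simp)
        have := mem (H.inv_mem_normalizer ha)
        rw [inv_inv'] at this
        simpa [h1] using this }

end ClosedInverseSubmonoid

/-! ## Edge-labelled graphs -/

/-- A graph in the sense of Serre with an orientation: `src e` is the initial vertex `α(e)`,
`inv e` the inverse edge, and exactly one of `e`, `inv e` is positively oriented. -/
structure SerreGraph where
  V : Type u
  E : Type v
  src : E → V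
  inv : E → E
  inv_inv : ∀ e, inv (inv e) = e
  inv_ne : ∀ e, inv e ≠ e
  pos : E → Prop
  pos_inv : ∀ e, pos (inv e) ↔ ¬ pos e

/-- The terminal vertex `ω(e)`. -/
def SerreGraph.tgt (Γ : SerreGraph.{u, v}) (e : Γ.E) : Γ.V := Γ.src (Γ.inv e)

/-- A graph whose edges are labelled over `X ∪ X⁻¹`; the letter `x` is `(x, true)` and `x⁻¹` is
`(x, false)`. No two positively oriented edges with the same initial or the same terminal vertex
have the same label. -/
structure LabelledGraph (X : Type w) extends SerreGraph.{u, v} where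
  label : E → X × Bool
  label_pos : ∀ e, (label e).2 = true ↔ pos e
  label_inv : ∀ e, label (inv e) = ((label e).1, !(label e).2)
  det_src : ∀ e e', pos e → pos e' → src e = src e' → label e = label e' → e = e'
  det_tgt : ∀ e e', pos e → pos e' → src (inv e) = src (inv e') → label e = label e' → e = e'

namespace SerreGraph

variable (Γ : SerreGraph.{u, v})

/-- `Γ.IsPath a l b`: the string of edges `l` is a path from `a` to `b`. -/
def IsPath : Γ.V → List Γ.E → Γ.V → Prop
  | a, [], b => a = b
  | a, e :: l, b => Γ.src e = a ∧ IsPath (Γ.tgt e) l b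

variable {Γ}

theorem isPath_append {a b : Γ.V} {l m : List Γ.E} :
    Γ.IsPath a (l ++ m) b ↔ ∃ c, Γ.IsPath a l c ∧ Γ.IsPath c m b := by
  induction l generalizing a with
  | nil => simp [IsPath]
  | cons e l ih => simp [IsPath, ih, and_assoc]

/-- The string `e_n⁻¹ ... e_1⁻¹`. -/
def revEdges (l : List Γ.E) : List Γ.E := (l.map Γ.inv).reverse

theorem revEdges_revEdges (l : List Γ.E) : revEdges (revEdges l) = l := by
  simp [revEdges, List.map_reverse, Γ.inv_inv, Function.comp_def]

theorem isPath_revEdges {a b : Γ.V} {l : List Γ.E} (h : Γ.IsPath a l b) :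
    Γ.IsPath b (revEdges l) a := by
  induction l generalizing a with
  | nil => exact Eq.symm h
  | cons e l ih =>
    obtain ⟨h1, h2⟩ := h
    have : revEdges (e :: l) = revEdges l ++ [Γ.inv e] := by simp [revEdges]
    rw [this, isPath_append]
    exact ⟨_, ih h2, rfl, by simpa [IsPath, tgt, Γ.inv_inv] using h1⟩

variable (Γ) in
/-- Paths from `a` to `b`: the morphisms of the free category on `Γ`. -/
def Path (a b : Γ.V) : Type v := {l : List Γ.E // Γ.IsPath a l b}

namespace Path

/-- The empty path. -/
def nil (a : Γ.V) : Γ.Path a a := ⟨[], rfl⟩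

/-- Concatenation. -/
def comp {a b c : Γ.V} (p : Γ.Path a b) (q : Γ.Path b c) : Γ.Path a c :=
  ⟨p.1 ++ q.1, isPath_append.2 ⟨b, p.2, q.2⟩⟩

/-- The inverse path. -/
def rev {a b : Γ.V} (p : Γ.Path a b) : Γ.Path b a := ⟨revEdges p.1, isPath_revEdges p.2⟩

theorem comp_assoc {a b c d : Γ.V} (p : Γ.Path a b) (q : Γ.Path b c) (r : Γ.Path c d) :
    (p.comp q).comp r = p.comp (q.comp r) := Subtype.ext (List.append_assoc _ _ _)

theorem nil_comp {a b : Γ.V} (p : Γ.Path a b) : (nil a).comp p = p := rfl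

theorem comp_nil {a b : Γ.V} (p : Γ.Path a b) : p.comp (nil b) = p :=
  Subtype.ext (List.append_nil _)

theorem rev_rev {a b : Γ.V} (p : Γ.Path a b) : p.rev.rev = p :=
  Subtype.ext (revEdges_revEdges _)

theorem rev_comp {a b c : Γ.V} (p : Γ.Path a b) (q : Γ.Path b c) :
    (p.comp q).rev = q.rev.comp p.rev :=
  Subtype.ext (by simp [rev, comp, revEdges])

end Path

variable (Γ) in
/-- A graph is connected if any two vertices are joined by a path. -/
def Connected : Prop := ∀ a b : Γ.V, Nonempty (Γ.Path a b)

/-! ### The free inverse category and its loop monoids -/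

/-- The congruence `∼_i` on the free category on `Γ`: the category congruence generated by
`p ∼ p p⁻¹ p` and `p p⁻¹ q q⁻¹ ∼ q q⁻¹ p p⁻¹` for paths `p`, `q` with the same initial vertex. -/
inductive InvCong : ∀ {a b : Γ.V}, Γ.Path a b → Γ.Path a b → Prop
  | refl {a b : Γ.V} (p : Γ.Path a b) : InvCong p p
  | symm {a b : Γ.V} {p q : Γ.Path a b} : InvCong p q → InvCong q p
  | trans {a b : Γ.V} {p q r : Γ.Path a b} : InvCong p q → InvCong q r → InvCong p r
  | comp {a b c : Γ.V} {p p' : Γ.Path a b} {q q' : Γ.Path b c} :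
      InvCong p p' → InvCong q q' → InvCong (p.comp q) (p'.comp q')
  | regular {a b : Γ.V} (p : Γ.Path a b) : InvCong p ((p.comp p.rev).comp p)
  | comm {a b c : Γ.V} (p : Γ.Path a b) (q : Γ.Path a c) :
      InvCong ((p.comp p.rev).comp (q.comp q.rev)) ((q.comp q.rev).comp (p.comp p.rev))

theorem InvCong.rev {a b : Γ.V} {p q : Γ.Path a b} (h : InvCong p q) :
    InvCong p.rev q.rev := by
  induction h with
  | refl p => exact .refl _
  | symm _ ih => exact ih.symm
  | trans _ _ ih ih' => exact ih.trans ih'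
  | comp _ _ ih ih' => rw [Path.rev_comp, Path.rev_comp]; exact ih'.comp ih
  | regular p =>
    have := InvCong.regular p.rev
    simpa only [Path.rev_comp, Path.rev_rev, Path.comp_assoc] using this
  | comm p q =>
    have := InvCong.comm q p
    simpa only [Path.rev_comp, Path.rev_rev, Path.comp_assoc] using this

/-- The setoid of `∼_i` on the paths from `a` to `b`. -/
def invSetoid (a b : Γ.V) : Setoid (Γ.Path a b) where
  r := InvCong
  iseqv := ⟨.refl, .symm, .trans⟩

variable (Γ) in
/-- The morphisms from `a` to `b` in the free inverse category `FIC(Γ)`: the classes `[[p]]` of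
paths from `a` to `b` modulo `∼_i`. -/
def FIC (a b : Γ.V) : Type v := Quotient (invSetoid (Γ := Γ) a b)

/-- The class `[[p]]`. -/
def Path.cls {a b : Γ.V} (p : Γ.Path a b) : Γ.FIC a b := Quotient.mk (invSetoid a b) p

/-- The composition `[[p]] [[q]] = [[pq]]`. -/
def FIC.comp {a b c : Γ.V} : Γ.FIC a b → Γ.FIC b c → Γ.FIC a c :=
  Quotient.map₂ Path.comp (fun _ _ h _ _ h' => InvCong.comp h h')

/-- The inverse `[[p]]⁻¹ = [[p⁻¹]]`. -/
def FIC.rev {a b : Γ.V} : Γ.FIC a b → Γ.FIC b a :=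
  Quotient.map Path.rev (fun _ _ h => InvCong.rev h)

variable (Γ) in
/-- The loop monoid `L(Γ, a)`: the endomorphisms of `a` in `FIC(Γ)`, i.e. the classes `[[p]]` of
circuits `p` at `a`. -/
def LoopMonoid (a : Γ.V) : Type v := Γ.FIC a a

namespace LoopMonoid

variable {a : Γ.V}

instance : Monoid (Γ.LoopMonoid a) where
  mul x y := FIC.comp x y
  one := (Path.nil a).cls
  mul_assoc x y z := by
    induction x, y, z using Quotient.inductionOn₃ with
    | h p q r => exact congrArg Path.cls (Path.comp_assoc p q r)
  one_mul x := by
    induction x using Quotient.inductionOn with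
    | h p => exact congrArg Path.cls (Path.nil_comp p)
  mul_one x := by
    induction x using Quotient.inductionOn with
    | h p => exact congrArg Path.cls (Path.comp_nil p)

instance : Inv (Γ.LoopMonoid a) := ⟨FIC.rev⟩

theorem regular (x : Γ.LoopMonoid a) : x * x⁻¹ * x = x := by
  induction x using Quotient.inductionOn with
  | h p => exact (Quotient.sound (s := invSetoid a a) (InvCong.regular p)).symm

theorem comm (x y : Γ.LoopMonoid a) : (x * x⁻¹) * (y * y⁻¹) = (y * y⁻¹) * (x * x⁻¹) := by
  induction x, y using Quotient.inductionOn₂ with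
  | h p q => exact Quotient.sound (s := invSetoid a a) (InvCong.comm p q)

theorem rev_rev (x : Γ.LoopMonoid a) : x⁻¹⁻¹ = x := by
  induction x using Quotient.inductionOn with
  | h p => exact congrArg Path.cls (Path.rev_rev p)

theorem rev_mul (x y : Γ.LoopMonoid a) : (x * y)⁻¹ = y⁻¹ * x⁻¹ := by
  induction x, y using Quotient.inductionOn₂ with
  | h p q => exact congrArg Path.cls (Path.rev_comp p q)

theorem regular' (x : Γ.LoopMonoid a) : x⁻¹ * x * x⁻¹ = x⁻¹ := by
  simpa only [rev_rev] using regular x⁻¹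

theorem idem_eq {e : Γ.LoopMonoid a} (he : e * e = e) : e = e * e⁻¹ := by
  have h1 : e⁻¹ * e⁻¹ = e⁻¹ := by rw [← rev_mul, he]
  have h2 : e⁻¹ = e := by
    calc e⁻¹ = e⁻¹ * (e * e) * e⁻¹ := by rw [he, regular']
      _ = (e⁻¹ * e⁻¹⁻¹) * (e * e⁻¹) := by rw [rev_rev]; simp only [mul_assoc]
      _ = (e * e⁻¹) * (e⁻¹ * e⁻¹⁻¹) := comm _ _
      _ = e * (e⁻¹ * e⁻¹) * e := by rw [rev_rev]; simp only [mul_assoc]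
      _ = e := by rw [h1, regular]
  rw [h2, he]

theorem idem_comm {e f : Γ.LoopMonoid a} (he : e * e = e) (hf : f * f = f) :
    e * f = f * e := by
  rw [idem_eq he, idem_eq hf]
  exact comm e f

instance : InverseMonoid (Γ.LoopMonoid a) where
  mul_inv_mul := regular
  inv_mul_inv := regular'
  inv_unique x y h1 h2 := by
    have i1 : (x * y) * (x * y) = x * y := by rw [← mul_assoc, h1]
    have i2 : (y * x) * (y * x) = y * x := by rw [← mul_assoc, h2]
    have i3 : (x * x⁻¹) * (x * x⁻¹) = x * x⁻¹ := by rw [← mul_assoc, regular]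
    have i4 : (x⁻¹ * x) * (x⁻¹ * x) = x⁻¹ * x := by rw [← mul_assoc, regular']
    calc y = y * x * y := h2.symm
      _ = y * (x * x⁻¹ * x) * y := by rw [regular]
      _ = y * ((x * x⁻¹) * (x * y)) := by simp only [mul_assoc]
      _ = (y * x * y) * x * x⁻¹ := by rw [idem_comm i3 i1]; simp only [mul_assoc]
      _ = (y * x) * (x⁻¹ * x * x⁻¹) := by rw [h2, regular']
      _ = ((y * x) * (x⁻¹ * x)) * x⁻¹ := by simp only [mul_assoc]
      _ = x⁻¹ * (x * y * x) * x⁻¹ := by rw [idem_comm i2 i4]; simp only [mul_assoc]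
      _ = x⁻¹ := by rw [h1, regular']

end LoopMonoid

end SerreGraph

/-! ## Immersions and deck transformations -/

namespace LabelledGraph

variable {X : Type w}

/-- A label-preserving morphism of graphs. -/
structure Hom (Δ : LabelledGraph.{u', v', w} X) (Γ : LabelledGraph.{u, v, w} X) where
  onV : Δ.V → Γ.V
  onE : Δ.E → Γ.E
  src_onE : ∀ e, Γ.src (onE e) = onV (Δ.src e)
  inv_onE : ∀ e, Γ.inv (onE e) = onE (Δ.inv e)
  pos_onE : ∀ e, Γ.pos (onE e) ↔ Δ.pos e
  label_onE : ∀ e, Γ.label (onE e) = Δ.label e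

variable {Δ : LabelledGraph.{u', v', w} X} {Γ : LabelledGraph.{u, v, w} X}

/-- An immersion: a morphism that is injective on every star set. -/
def Hom.IsImmersion (f : Hom Δ Γ) : Prop :=
  ∀ e e' : Δ.E, Δ.src e = Δ.src e' → f.onE e = f.onE e' → e = e'

/-- The group of labelled graph automorphisms: pairs of permutations, of the vertices and of the
edges, that form a label-preserving graph morphism; the product is composition. -/
def autGroup (Δ : LabelledGraph.{u', v', w} X) :
    Subgroup (Equiv.Perm Δ.V × Equiv.Perm Δ.E) where
  carrier := {γ | ∃ φ : Hom Δ Δ, φ.onV = γ.1 ∧ φ.onE = γ.2}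
  one_mem' := ⟨⟨id, id, fun _ => rfl, fun _ => rfl, fun _ => Iff.rfl, fun _ => rfl⟩, rfl, rfl⟩
  mul_mem' := by
    rintro γ δ ⟨φ, h1, h2⟩ ⟨ψ, h3, h4⟩
    refine ⟨⟨φ.onV ∘ ψ.onV, φ.onE ∘ ψ.onE, ?_, ?_, ?_, ?_⟩, ?_, ?_⟩
    · intro e; simp [φ.src_onE, ψ.src_onE]
    · intro e; simp [φ.inv_onE, ψ.inv_onE]
    · intro e; simp [φ.pos_onE, ψ.pos_onE]
    · intro e; simp [φ.label_onE, ψ.label_onE]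
    · simp [h1, h3]
    · simp [h2, h4]
  inv_mem' := by
    rintro γ ⟨φ, h1, h2⟩
    have e1 : ∀ e, φ.onE (γ.2⁻¹ e) = e := fun e => by rw [h2]; exact γ.2.apply_symm_apply e
    refine ⟨⟨⇑γ.1⁻¹, ⇑γ.2⁻¹, ?_, ?_, ?_, ?_⟩, rfl, rfl⟩
    · intro e
      apply γ.1.injective
      rw [← h1, ← φ.src_onE, e1, h1]
      exact (γ.1.apply_symm_apply _).symm
    · intro e
      apply γ.2.injective
      rw [← h2, ← φ.inv_onE, e1, e1]
    · intro e; rw [← φ.pos_onE, e1]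
    · intro e; rw [← φ.label_onE, e1]

/-- The group `G(Δ)` of deck transformations of `f : Δ → Γ`: the labelled graph automorphisms `γ`
of `Δ` with `f ∘ γ = f`, i.e. `f (γ v) = f v` for all vertices `v`. -/
def deckGroup (f : Hom Δ Γ) : Subgroup (autGroup Δ) where
  carrier := {γ | ∀ v : Δ.V, f.onV (γ.1.1 v) = f.onV v}
  one_mem' := fun _ => rfl
  mul_mem' := by
    intro γ δ h h' v
    exact (h (δ.1.1 v)).trans (h' v)
  inv_mem' := by
    intro γ h v
    exact (h (γ.1.1⁻¹ v)).symm.trans (congrArg f.onV (γ.1.1.apply_symm_apply v))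

/-- Labelled edges are determined by their initial vertex and label. -/
theorem label_inj {e e' : Γ.E} (h : Γ.src e = Γ.src e') (h' : Γ.label e = Γ.label e') :
    e = e' := by
  by_cases hp : Γ.pos e
  · have hp' : Γ.pos e' := by rw [← Γ.label_pos, ← h', Γ.label_pos]; exact hp
    exact Γ.det_src e e' hp hp' h h'
  · have hp' : ¬ Γ.pos e' := by rw [← Γ.label_pos, ← h', Γ.label_pos]; exact hp
    have : Γ.inv e = Γ.inv e' := by
      apply Γ.det_tgt _ _ ((Γ.pos_inv e).2 hp) ((Γ.pos_inv e').2 hp')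
      · rw [Γ.inv_inv, Γ.inv_inv, h]
      · rw [Γ.label_inv, Γ.label_inv, h']
    rw [← Γ.inv_inv e, this, Γ.inv_inv]

/-- A deck transformation satisfies `f ∘ γ = f` on edges as well. -/
theorem deckGroup_onE (f : Hom Δ Γ) (γ : autGroup Δ) (h : γ ∈ deckGroup f) (e : Δ.E) :
    f.onE (γ.1.2 e) = f.onE e := by
  obtain ⟨φ, h1, h2⟩ := γ.2
  apply label_inj
  · rw [f.src_onE, f.src_onE, ← h2, φ.src_onE, h1]
    exact h _
  · rw [f.label_onE, f.label_onE, ← h2, φ.label_onE]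

/-! ### The closed inverse submonoid that defines an immersion -/

theorem Hom.isPath_map (f : Hom Δ Γ) {a b : Δ.V} {l : List Δ.E} (h : Δ.IsPath a l b) :
    Γ.IsPath (f.onV a) (l.map f.onE) (f.onV b) := by
  induction l generalizing a with
  | nil => exact congrArg f.onV h
  | cons e l ih =>
    obtain ⟨h1, h2⟩ := h
    refine ⟨by rw [f.src_onE, h1], ?_⟩
    have := ih h2
    rwa [SerreGraph.tgt, ← f.src_onE, ← f.inv_onE] at this

/-- The image under `f` of a circuit at `a`, as a circuit at `v = f a`. -/
def Hom.mapCircuit (f : Hom Δ Γ) {a : Δ.V} {v : Γ.V} (hv : f.onV a = v) (p : Δ.Path a a) :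
    Γ.Path v v :=
  ⟨p.1.map f.onE, hv ▸ f.isPath_map p.2⟩

theorem Hom.map_revEdges (f : Hom Δ Γ) (l : List Δ.E) :
    (SerreGraph.revEdges l).map f.onE = SerreGraph.revEdges (l.map f.onE) := by
  simp [SerreGraph.revEdges, List.map_reverse, Function.comp_def, f.inv_onE]

/-- `f.Lifts l a b`: some path from `a` to `b` in `Δ` is mapped by `f` to the string `l`. -/
def Hom.Lifts (f : Hom Δ Γ) (l : List Γ.E) (a b : Δ.V) : Prop :=
  ∃ m : List Δ.E, Δ.IsPath a m b ∧ m.map f.onE = l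

theorem Hom.lifts_append (f : Hom Δ Γ) {l l' : List Γ.E} {a b : Δ.V} :
    f.Lifts (l ++ l') a b ↔ ∃ c, f.Lifts l a c ∧ f.Lifts l' c b := by
  constructor
  · rintro ⟨m, hm, h⟩
    obtain ⟨m₁, m₂, rfl, rfl, rfl⟩ := List.map_eq_append_iff.1 h
    obtain ⟨c, h1, h2⟩ := SerreGraph.isPath_append.1 hm
    exact ⟨c, ⟨m₁, h1, rfl⟩, ⟨m₂, h2, rfl⟩⟩
  · rintro ⟨c, ⟨m₁, h1, rfl⟩, ⟨m₂, h2, rfl⟩⟩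
    exact ⟨m₁ ++ m₂, SerreGraph.isPath_append.2 ⟨c, h1, h2⟩, by simp⟩

theorem Hom.lifts_rev (f : Hom Δ Γ) {l : List Γ.E} {a b : Δ.V} :
    f.Lifts (SerreGraph.revEdges l) a b ↔ f.Lifts l b a := by
  have key : ∀ {l : List Γ.E} {a b : Δ.V}, f.Lifts l a b →
      f.Lifts (SerreGraph.revEdges l) b a := by
    rintro l a b ⟨m, hm, rfl⟩
    exact ⟨SerreGraph.revEdges m, SerreGraph.isPath_revEdges hm, f.map_revEdges m⟩
  exact ⟨fun h => by simpa only [SerreGraph.revEdges_revEdges] using key h, key⟩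

theorem Hom.IsImmersion.lifts_unique {f : Hom Δ Γ} (hf : f.IsImmersion) {l : List Γ.E}
    {a b c : Δ.V} (h : f.Lifts l a b) (h' : f.Lifts l a c) : b = c := by
  obtain ⟨m, hm, rfl⟩ := h
  obtain ⟨m', hm', h'⟩ := h'
  induction m generalizing a m' with
  | nil =>
    obtain rfl : m' = [] := by simpa using h'
    exact Eq.trans (Eq.symm hm) hm'
  | cons e m ih =>
    obtain ⟨e', m', rfl, h1, h2⟩ := List.map_eq_cons_iff.1 h'
    obtain rfl : e = e' := hf _ _ (hm.1.trans hm'.1.symm) h1.symm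
    exact ih hm.2 m' hm'.2 h2

theorem Hom.IsImmersion.lifts_congr {f : Hom Δ Γ} (hf : f.IsImmersion) {v w : Γ.V}
    {p q : Γ.Path v w} (h : SerreGraph.InvCong p q) :
    ∀ a b : Δ.V, f.Lifts p.1 a b ↔ f.Lifts q.1 a b := by
  have loop : ∀ {v w : Γ.V} (p : Γ.Path v w) (a b : Δ.V),
      f.Lifts (p.comp p.rev).1 a b ↔ a = b ∧ ∃ c, f.Lifts p.1 a c := by
    intro v w p a b
    constructor
    · intro h
      obtain ⟨c, h1, h2⟩ := f.lifts_append.1 h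
      have h2 := f.lifts_rev.1 h2
      exact ⟨hf.lifts_unique (f.lifts_rev.2 h1) (f.lifts_rev.2 h2), c, h1⟩
    · rintro ⟨rfl, c, h⟩
      exact f.lifts_append.2 ⟨c, h, f.lifts_rev.2 h⟩
  induction h with
  | refl p => exact fun _ _ => Iff.rfl
  | symm _ ih => exact fun a b => (ih a b).symm
  | trans _ _ ih ih' => exact fun a b => (ih a b).trans (ih' a b)
  | comp _ _ ih ih' =>
    intro a b
    refine f.lifts_append.trans (Iff.trans ?_ f.lifts_append.symm)
    exact exists_congr fun c => and_congr (ih a c) (ih' c b)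
  | regular p =>
    intro a b
    refine Iff.trans ?_ f.lifts_append.symm
    constructor
    · exact fun h => ⟨a, (loop p a a).2 ⟨rfl, b, h⟩, h⟩
    · rintro ⟨c, h1, h2⟩
      obtain ⟨rfl, -⟩ := (loop p a c).1 h1
      exact h2
  | comm p q =>
    intro a b
    refine f.lifts_append.trans (Iff.trans ?_ f.lifts_append.symm)
    simp only [loop]
    constructor
    · rintro ⟨c, ⟨rfl, h⟩, rfl, h'⟩; exact ⟨_, ⟨rfl, h'⟩, rfl, h⟩
    · rintro ⟨c, ⟨rfl, h⟩, rfl, h'⟩; exact ⟨_, ⟨rfl, h'⟩, rfl, h⟩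

/-- `H = f(L(Δ, a)) = {[[f p]] : p a circuit at a}`, the closed inverse submonoid of `L(Γ, v)`,
`v = f a`, that defines the immersion `f`. -/
def Hom.loopImage (f : Hom Δ Γ) (hf : f.IsImmersion) {a : Δ.V} {v : Γ.V} (hv : f.onV a = v) :
    ClosedInverseSubmonoid (Γ.LoopMonoid v) where
  carrier := {x | ∃ p : Δ.Path a a, (f.mapCircuit hv p).cls = x}
  one_mem' := ⟨SerreGraph.Path.nil a, rfl⟩
  mul_mem' := by
    rintro _ _ ⟨p, rfl⟩ ⟨q, rfl⟩
    refine ⟨p.comp q, congrArg SerreGraph.Path.cls (Subtype.ext ?_)⟩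
    simp [Hom.mapCircuit, SerreGraph.Path.comp]
  inv_mem := by
    rintro _ ⟨p, rfl⟩
    exact ⟨p.rev, congrArg SerreGraph.Path.cls (Subtype.ext (f.map_revEdges p.1))⟩
  closed := by
    ext x
    constructor
    · rintro ⟨_, ⟨p, rfl⟩, e, he, hx⟩
      -- above a class that lifts to a circuit there are only classes that lift to circuits
      induction x using Quotient.inductionOn with
      | h q =>
      induction e using Quotient.inductionOn with
      | h r =>
      have hr : SerreGraph.InvCong (r.comp r) r := Quotient.exact (s := SerreGraph.invSetoid v v) he
      have hpq : SerreGraph.InvCong (f.mapCircuit hv p) (r.comp q) :=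
        Quotient.exact (s := SerreGraph.invSetoid v v) hx
      have hl : f.Lifts (r.1 ++ q.1) a a := (hf.lifts_congr hpq a a).1 ⟨p.1, p.2, rfl⟩
      obtain ⟨c, h1, h2⟩ := f.lifts_append.1 hl
      obtain ⟨d, h3, h4⟩ := f.lifts_append.1 ((hf.lifts_congr hr a c).2 h1)
      obtain rfl := hf.lifts_unique h1 h3
      obtain rfl : c = a := hf.lifts_unique (f.lifts_rev.2 h4) (f.lifts_rev.2 h1)
      obtain ⟨m, hm, hmq⟩ := h2
      exact ⟨⟨m, hm⟩, congrArg SerreGraph.Path.cls (Subtype.ext hmq)⟩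
    · exact fun hx => ⟨x, hx, InverseMonoid.NatLE.refl x⟩

end LabelledGraph

namespace SerreGraph

/-! This is the covering-space argument with one difference: paths of `Γ` lift uniquely along an
immersion, but need not lift at all. Being liftable from `a` to `b` depends only on the class of a
path, so `H` consists of the classes that lift to circuits at the base vertex `a`
(`Hom.mem_loopImage`).

If `q` lifts to a path from `a` to `b`, then `q r q⁻¹` lies in `H` exactly when `r` lifts to a
circuit at `b`. Hence `[[q]]` normalizes `H` exactly when `q` lifts from `a` to some `b` at which
the same paths lift to circuits as at `a`. For `Δ` connected, these `b` are the translates of `a`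
under deck transformations (`Hom.IsImmersion.exists_deck`, `Hom.mem_normalizer_loopImage`).

Two elements of the normalizer have the same right ω-coset exactly when their lifts from `a` end at
the same vertex (`Hom.mul_inv_mem_loopImage`), and a deck transformation is determined by where it
sends `a` (`Hom.IsImmersion.deck_ext`). Cosets and deck transformations thus both correspond to the
translates of `a`. The isomorphism sends `γ` to the coset of the image of any path from `a` to `γ
a`. -/

theorem IsPath.right_unique {Γ : SerreGraph.{u, v}} {a b c : Γ.V} {l : List Γ.E}
    (h : Γ.IsPath a l b) (h' : Γ.IsPath a l c) : b = c := by
  induction l generalizing a with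
  | nil => exact Eq.trans (Eq.symm h) h'
  | cons e l ih => exact ih h.2 h'.2

/-- The class `[[p]]` of a circuit as an element of the loop monoid. -/
abbrev Path.loopCls {Γ : SerreGraph.{u, v}} {a : Γ.V} (p : Γ.Path a a) : Γ.LoopMonoid a := p.cls

end SerreGraph

namespace LabelledGraph

variable {X : Type w} {Δ : LabelledGraph.{u', v', w} X} {Γ : LabelledGraph.{u, v, w} X}

theorem Hom.Lifts.isPath {f : Hom Δ Γ} {l : List Γ.E} {a b : Δ.V} (h : f.Lifts l a b) :
    Γ.IsPath (f.onV a) l (f.onV b) := by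
  obtain ⟨m, hm, rfl⟩ := h
  exact f.isPath_map hm

/-- An endomorphism over `f` carries lifts of a path to lifts of the same path. -/
theorem Hom.Lifts.map {f : Hom Δ Γ} {φ : Hom Δ Δ} (hφ : ∀ e, f.onE (φ.onE e) = f.onE e)
    {l : List Γ.E} {a b : Δ.V} (h : f.Lifts l a b) : f.Lifts l (φ.onV a) (φ.onV b) := by
  obtain ⟨m, hm, rfl⟩ := h
  exact ⟨m.map φ.onE, φ.isPath_map hm, by simp [Function.comp_def, hφ]⟩

/-! ### Deck transformations built from lifting data -/

/-- If every path of `Γ` that lifts to a circuit at `a` lifts to a circuit at `b`, then some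
endomorphism of `Δ` over `f` carries `a` to `b`. -/
theorem Hom.IsImmersion.exists_endomorphism {f : Hom Δ Γ} (hf : f.IsImmersion)
    (hΔ : Δ.Connected) {a b : Δ.V} (hab : f.onV a = f.onV b)
    (h : ∀ l, f.Lifts l a a → f.Lifts l b b) :
    ∃ φ : Hom Δ Δ, φ.onV a = b ∧ (∀ x, f.onV (φ.onV x) = f.onV x) ∧
      ∀ e, f.onE (φ.onE e) = f.onE e := by
  -- Liftability passes from `a` to `b`: `l l⁻¹` lifts to a circuit at `a`, hence at `b`, and the
  -- first half of that circuit lifts `l`.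
  have lift : ∀ {l x}, f.Lifts l a x → ∃ y, f.Lifts l b y := by
    intro l x hl
    obtain ⟨y, hy, -⟩ := f.lifts_append.1 (h _ (f.lifts_append.2 ⟨x, hl, f.lifts_rev.2 hl⟩))
    exact ⟨y, hy⟩
  -- Well-definedness of the vertex map: apply the hypothesis to `l l'⁻¹`, a circuit at `a`.
  have unique : ∀ {l l' x y y'}, f.Lifts l a x → f.Lifts l' a x → f.Lifts l b y →
      f.Lifts l' b y' → y = y' := by
    intro l l' x y y' hl hl' hy hy'
    obtain ⟨z, hz, hz'⟩ :=
      f.lifts_append.1 (h _ (f.lifts_append.2 ⟨x, hl, f.lifts_rev.2 hl'⟩))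
    exact (hf.lifts_unique hy hz).trans (hf.lifts_unique (f.lifts_rev.1 hz') hy')
  have reach : ∀ x, ∃ y l, f.Lifts l a x ∧ f.Lifts l b y := by
    intro x
    obtain ⟨p⟩ := hΔ a x
    have hp : f.Lifts (p.1.map f.onE) a x := ⟨p.1, p.2, rfl⟩
    obtain ⟨y, hy⟩ := lift hp
    exact ⟨y, _, hp, hy⟩
  choose φ w hw hφ using reach
  -- The image of `e` is the last edge of the lift at `b` of `w (Δ.src e)` extended by `f.onE e`;
  -- `unique` compares its end with `φ (Δ.tgt e)`, which was defined by another path.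
  have edge : ∀ e, ∃ e', Δ.src e' = φ (Δ.src e) ∧ f.onE e' = f.onE e ∧
      Δ.tgt e' = φ (Δ.tgt e) := by
    intro e
    have he : f.Lifts (w (Δ.src e) ++ [f.onE e]) a (Δ.tgt e) :=
      f.lifts_append.2 ⟨_, hw _, [e], ⟨rfl, rfl⟩, rfl⟩
    obtain ⟨y, hy⟩ := lift he
    obtain ⟨z, hz, m, hm, hme⟩ := f.lifts_append.1 hy
    obtain rfl := hf.lifts_unique hz (hφ _)
    obtain ⟨e', rfl, he'⟩ := List.map_eq_singleton_iff.1 hme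
    exact ⟨e', hm.1, he', hm.2.trans (unique he (hw _) hy (hφ _))⟩
  choose ψ hsrc hψ htgt using edge
  refine ⟨⟨φ, ψ, hsrc, ?_, ?_, ?_⟩, ?_, ?_, hψ⟩
  · intro e
    -- Both edges start at `φ (Δ.tgt e)` and have the same image, so injectivity on stars identifies
    -- them.
    apply hf
    · rw [hsrc]; exact htgt e
    · rw [hψ, ← f.inv_onE, ← f.inv_onE, hψ]
  · intro e; rw [← f.pos_onE, hψ, f.pos_onE]
  · intro e; rw [← f.label_onE, hψ, f.label_onE]
  -- The chosen `w a` need not be empty; it is compared with the empty path.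
  · exact unique (hw a) ⟨[], rfl, rfl⟩ (hφ a) ⟨[], rfl, rfl⟩
  · intro x
    have hx := (hw x).isPath
    rw [hab] at hx
    exact (hφ x).isPath.right_unique hx

/-- Two endomorphisms over an immersion that carry `a` to `b` and back are mutually inverse. -/
theorem Hom.IsImmersion.leftInverse {f : Hom Δ Γ} (hf : f.IsImmersion) (hΔ : Δ.Connected)
    {φ ψ : Hom Δ Δ} (hφ : ∀ e, f.onE (φ.onE e) = f.onE e)
    (hψ : ∀ e, f.onE (ψ.onE e) = f.onE e) {a : Δ.V} (h : ψ.onV (φ.onV a) = a) :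
    Function.LeftInverse ψ.onV φ.onV ∧ Function.LeftInverse ψ.onE φ.onE := by
  have hV : Function.LeftInverse ψ.onV φ.onV := by
    intro x
    obtain ⟨p⟩ := hΔ a x
    have hp : f.Lifts (p.1.map f.onE) a x := ⟨p.1, p.2, rfl⟩
    -- Applying `φ` and then `ψ` to a path from `a` to `x` gives another lift of the same string
    -- from `a`.
    have := (hp.map hφ).map hψ
    rw [h] at this
    exact hf.lifts_unique this hp
  refine ⟨hV, fun e => hf _ _ ?_ ?_⟩
  · rw [ψ.src_onE, φ.src_onE, hV]
  · rw [hψ, hφ]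

/-- If the same paths of `Γ` lift to circuits at `a` and at `b`, then some deck transformation
carries `a` to `b`. -/
theorem Hom.IsImmersion.exists_deck {f : Hom Δ Γ} (hf : f.IsImmersion) (hΔ : Δ.Connected)
    {a b : Δ.V} (hab : f.onV a = f.onV b) (h : ∀ l, f.Lifts l a a ↔ f.Lifts l b b) :
    ∃ γ : deckGroup f, γ.1.1.1 a = b := by
  obtain ⟨φ, hφa, hφV, hφ⟩ := hf.exists_endomorphism hΔ hab fun l => (h l).1
  obtain ⟨ψ, hψb, -, hψ⟩ := hf.exists_endomorphism hΔ hab.symm fun l => (h l).2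
  obtain ⟨h1, h2⟩ := hf.leftInverse hΔ hφ hψ (a := a) (by rw [hφa, hψb])
  obtain ⟨h3, h4⟩ := hf.leftInverse hΔ hψ hφ (a := b) (by rw [hψb, hφa])
  exact ⟨⟨⟨(⟨φ.onV, ψ.onV, h1, h3⟩, ⟨φ.onE, ψ.onE, h2, h4⟩), φ, rfl, rfl⟩, hφV⟩, hφa⟩

/-! ### Action of deck transformations on lifts -/

theorem Hom.Lifts.deck {f : Hom Δ Γ} {l : List Γ.E} {a b : Δ.V} (h : f.Lifts l a b)
    (γ : deckGroup f) : f.Lifts l (γ.1.1.1 a) (γ.1.1.1 b) := by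
  obtain ⟨φ, h1, h2⟩ := γ.1.2
  rw [← h1]
  exact h.map fun e => by rw [h2]; exact deckGroup_onE f γ.1 γ.2 e

theorem Hom.lifts_deck_iff {f : Hom Δ Γ} {l : List Γ.E} {a b : Δ.V} (γ : deckGroup f) :
    f.Lifts l (γ.1.1.1 a) (γ.1.1.1 b) ↔ f.Lifts l a b := by
  refine ⟨fun h => ?_, fun h => h.deck γ⟩
  have := h.deck γ⁻¹
  have inv_apply : ∀ x, (γ⁻¹).1.1.1 (γ.1.1.1 x) = x := γ.1.1.1.symm_apply_apply
  rwa [inv_apply, inv_apply] at this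

/-- A deck transformation of an immersion is determined by the image of one vertex. -/
theorem Hom.IsImmersion.deck_ext {f : Hom Δ Γ} (hf : f.IsImmersion) (hΔ : Δ.Connected)
    {γ δ : deckGroup f} {a : Δ.V} (h : γ.1.1.1 a = δ.1.1.1 a) : γ = δ := by
  have hV : ∀ x, γ.1.1.1 x = δ.1.1.1 x := by
    intro x
    obtain ⟨p⟩ := hΔ a x
    have hp : f.Lifts (p.1.map f.onE) a x := ⟨p.1, p.2, rfl⟩
    have hγ := hp.deck γ
    rw [h] at hγ
    exact hf.lifts_unique hγ (hp.deck δ)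
  have src_apply : ∀ (ε : deckGroup f) (e : Δ.E), Δ.src (ε.1.1.2 e) = ε.1.1.1 (Δ.src e) := by
    intro ε e
    obtain ⟨φ, h1, h2⟩ := ε.1.2
    rw [← h1, ← h2, φ.src_onE]
  refine Subtype.ext (Subtype.ext (Prod.ext (Equiv.ext hV) (Equiv.ext fun e => hf _ _ ?_ ?_)))
  · rw [src_apply, src_apply, hV]
  · exact (deckGroup_onE f γ.1 γ.2 e).trans (deckGroup_onE f δ.1 δ.2 e).symm

/-! ### The submonoid `H` and its normalizer in terms of lifts -/

section LoopImage

variable {f : Hom Δ Γ} (hf : f.IsImmersion) {a : Δ.V} {v : Γ.V} (hv : f.onV a = v)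

/-- By `lifts_congr`, any representative of a class may be tested, not only one of the form
`f.mapCircuit hv p`. -/
theorem Hom.mem_loopImage {q : Γ.Path v v} :
    q.loopCls ∈ (f.loopImage hf hv).toSubmonoid ↔ f.Lifts q.1 a a := by
  constructor
  · rintro ⟨p, hp⟩
    have hc : SerreGraph.InvCong (f.mapCircuit hv p) q :=
      Quotient.exact (s := SerreGraph.invSetoid v v) hp
    exact (hf.lifts_congr hc a a).1 ⟨p.1, p.2, rfl⟩
  · rintro ⟨m, hm, hmq⟩
    exact ⟨⟨m, hm⟩, congrArg SerreGraph.Path.cls (Subtype.ext hmq)⟩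

/-- Conjugation by `q` moves the base vertex from `a` to `b`: by uniqueness of lifts, the outer
factors must run from `a` to `b` and back, which leaves a circuit at `b` for `r`. -/
theorem Hom.mul_mul_inv_mem_loopImage {q r : Γ.Path v v} {b : Δ.V} (hq : f.Lifts q.1 a b) :
    (q.loopCls * r.loopCls * q.loopCls⁻¹) ∈ (f.loopImage hf hv).toSubmonoid ↔
      f.Lifts r.1 b b := by
  refine (Hom.mem_loopImage hf hv (q := (q.comp r).comp q.rev)).trans
    (f.lifts_append.trans ?_)
  constructor
  · rintro ⟨d, h1, h2⟩
    obtain ⟨c, h3, h4⟩ := f.lifts_append.1 h1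
    obtain rfl := hf.lifts_unique hq h3
    obtain rfl := hf.lifts_unique hq (f.lifts_rev.1 h2)
    exact h4
  · intro h
    exact ⟨b, f.lifts_append.2 ⟨b, hq, h⟩, f.lifts_rev.2 hq⟩

/-- With `rightOmegaCoset_eq_iff`, this identifies a coset with the endpoint of a lift. -/
theorem Hom.mul_inv_mem_loopImage {q r : Γ.Path v v} {b c : Δ.V} (hq : f.Lifts q.1 a b)
    (hr : f.Lifts r.1 a c) :
    (q.loopCls * r.loopCls⁻¹) ∈ (f.loopImage hf hv).toSubmonoid ↔ b = c := by
  refine (Hom.mem_loopImage hf hv (q := q.comp r.rev)).trans (f.lifts_append.trans ?_)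
  constructor
  · rintro ⟨d, h1, h2⟩
    exact (hf.lifts_unique hq h1).trans (hf.lifts_unique (f.lifts_rev.1 h2) hr)
  · rintro rfl
    exact ⟨b, hq, f.lifts_rev.2 hr⟩

/-- The normalizer of `f(L(Δ, a))` consists of the classes of the paths that lift to a path from
`a` to a translate of `a` under a deck transformation. -/
theorem Hom.mem_normalizer_loopImage (hΔ : Δ.Connected) {q : Γ.Path v v} :
    q.loopCls ∈ (f.loopImage hf hv).normalizer ↔
      ∃ γ : deckGroup f, f.Lifts q.1 a (γ.1.1.1 a) := by
  constructor
  · rintro ⟨h1, h2⟩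
    have hqq : (q.loopCls * q.loopCls⁻¹) ∈ (f.loopImage hf hv).toSubmonoid :=
      (f.loopImage hf hv).mul_inv_mem_of_normalizer ⟨h1, h2⟩
    -- Since `1 ∈ H`, also `q q⁻¹ ∈ H`; this is what makes `q` liftable at `a`.
    obtain ⟨b, hb, -⟩ := f.lifts_append.1 ((Hom.mem_loopImage hf hv (q := q.comp q.rev)).1 hqq)
    have hvb : f.onV b = v := by
      have := hb.isPath
      rw [hv] at this
      exact this.right_unique q.2
    suffices h : ∀ l, f.Lifts l a a ↔ f.Lifts l b b by
      obtain ⟨γ, hγ⟩ := hf.exists_deck hΔ (hv.trans hvb.symm) h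
      exact ⟨γ, by rwa [hγ]⟩
    intro l
    constructor
    · intro hl
      have hlv := hl.isPath
      rw [hv] at hlv
      let r : Γ.Path v v := ⟨l, hlv⟩
      exact (Hom.mul_mul_inv_mem_loopImage hf hv (r := r) hb).1
        (h1 r.loopCls ((Hom.mem_loopImage hf hv (q := r)).2 hl))
    · intro hl
      have hlv := hl.isPath
      rw [hvb] at hlv
      let r : Γ.Path v v := ⟨l, hlv⟩
      -- Here `q r q⁻¹ ∈ H`, so `q⁻¹(q r q⁻¹)q ∈ H`. In its lift at `a`, the initial `q⁻¹` leads to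
      -- a vertex `c` from which `q` lifts back to `a`. The middle factor is then a circuit at `c`,
      -- and stripping off `q` and `q⁻¹` leaves a circuit at `a` lifting `r`.
      have h3 := h2 _ ((Hom.mul_mul_inv_mem_loopImage hf hv (r := r) hb).2 hl)
      have h4 := (Hom.mem_loopImage hf hv
        (q := (q.rev.comp ((q.comp r).comp q.rev)).comp q)).1 h3
      obtain ⟨c, h5, h6⟩ := f.lifts_append.1 h4
      obtain ⟨d, h7, h8⟩ := f.lifts_append.1 h5
      obtain rfl := hf.lifts_unique (f.lifts_rev.2 h6) h7
      obtain ⟨d', h9, h10⟩ := f.lifts_append.1 h8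
      obtain ⟨d'', h11, h12⟩ := f.lifts_append.1 h9
      have h13 := f.lifts_rev.1 h7
      obtain rfl := hf.lifts_unique h13 h11
      obtain rfl := hf.lifts_unique h13 (f.lifts_rev.1 h10)
      exact h12
  · rintro ⟨γ, hγ⟩
    -- Translating the lift of `q` by `γ⁻¹` and reversing it puts `q⁻¹` in the same situation as
    -- `q`, with `γ⁻¹` for `γ`; each gives one of the two normalizer conditions.
    have hγ' : f.Lifts q.rev.1 a (γ⁻¹.1.1.1 a) := by
      refine f.lifts_rev.2 ?_
      have := hγ.deck γ⁻¹
      have inv_apply : γ⁻¹.1.1.1 (γ.1.1.1 a) = a := γ.1.1.1.symm_apply_apply a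
      rwa [inv_apply] at this
    constructor
    · intro h hh
      induction h using Quotient.inductionOn with
      | h r =>
        exact (Hom.mul_mul_inv_mem_loopImage hf hv hγ).2
          ((Hom.lifts_deck_iff γ).2 ((Hom.mem_loopImage hf hv).1 hh))
    · intro h hh
      induction h using Quotient.inductionOn with
      | h r =>
        have := (Hom.mul_mul_inv_mem_loopImage hf hv (r := r) hγ').2
          ((Hom.lifts_deck_iff γ⁻¹).2 ((Hom.mem_loopImage hf hv).1 hh))
        have hrev : q.rev.loopCls⁻¹ = q.loopCls :=
          SerreGraph.LoopMonoid.rev_rev q.loopCls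
        rwa [hrev] at this

end LoopImage

end LabelledGraph

/-! ### The isomorphism -/

theorem mainTheorem1 {X : Type w} (Δ : LabelledGraph.{u', v', w} X) (Γ : LabelledGraph.{u, v, w} X)
    (hΔ : Δ.Connected) (hΓ : Γ.Connected)
    (f : LabelledGraph.Hom Δ Γ) (hf : f.IsImmersion)
    (v₀ : Γ.V) (a₀ : Δ.V) (ha₀ : f.onV a₀ = v₀) :
    Nonempty (LabelledGraph.deckGroup f ≃* (f.loopImage hf ha₀).CosetGroup) := by
  set H := f.loopImage hf ha₀ with hH
  have reach : ∀ γ : LabelledGraph.deckGroup f,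
      ∃ q : Γ.Path v₀ v₀, f.Lifts q.1 a₀ (γ.1.1.1 a₀) := by
    intro γ
    obtain ⟨p⟩ := hΔ a₀ (γ.1.1.1 a₀)
    have hp := f.isPath_map p.2
    -- The projected path closes up because `γ` preserves the fibre over `v₀`.
    rw [γ.2 a₀, ha₀] at hp
    exact ⟨⟨_, hp⟩, p.1, p.2, rfl⟩
  choose q hq using reach
  have mem : ∀ γ, (q γ).loopCls ∈ H.normalizer := fun γ =>
    (LabelledGraph.Hom.mem_normalizer_loopImage hf ha₀ hΔ).2 ⟨γ, hq γ⟩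
  have rho_iff : ∀ {r s : Γ.Path v₀ v₀} {b c : Δ.V}
      (hr : r.loopCls ∈ H.normalizer)
      (hs : s.loopCls ∈ H.normalizer),
      f.Lifts r.1 a₀ b → f.Lifts s.1 a₀ c → (H.rho ⟨r.loopCls, hr⟩ ⟨s.loopCls, hs⟩ ↔ b = c) := by
    intro r s b c hr hs hb hc
    exact (H.rightOmegaCoset_eq_iff (H.mul_inv_mem_of_normalizer hr)
      (H.mul_inv_mem_of_normalizer hs)).trans
      (LabelledGraph.Hom.mul_inv_mem_loopImage hf ha₀ hb hc)
  let θ : LabelledGraph.deckGroup f →* H.CosetGroup :=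
    MonoidHom.mk' (fun γ => Quotient.mk H.rho.toSetoid ⟨(q γ).loopCls, mem γ⟩) (by
      intro γ δ
      refine Quotient.sound (s := H.rho.toSetoid) ?_
      -- The lift of `q γ` followed by the `γ`-translate of the lift of `q δ` ends at `γ (δ a₀)`, as
      -- does the lift of `q (γ * δ)`. The order of factors is kept, so the map is a homomorphism
      -- and not an antihomomorphism.
      exact (rho_iff (s := (q γ).comp (q δ)) (mem (γ * δ)) (H.normalizer.mul_mem (mem γ) (mem δ))
        (hq (γ * δ)) (f.lifts_append.2 ⟨_, hq γ, (hq δ).deck γ⟩)).2 rfl)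
  refine ⟨MulEquiv.ofBijective θ ⟨?_, ?_⟩⟩
  · intro γ δ h
    exact hf.deck_ext hΔ ((rho_iff (mem γ) (mem δ) (hq γ) (hq δ)).1
      (Quotient.exact (s := H.rho.toSetoid) h))
  · intro x
    induction x using Quotient.inductionOn with
    | h x =>
      obtain ⟨x, hx⟩ := x
      induction x using Quotient.inductionOn with
      | h r =>
        obtain ⟨γ, hγ⟩ := (LabelledGraph.Hom.mem_normalizer_loopImage hf ha₀ hΔ).1 hx
        exact ⟨γ, Quotient.sound (s := H.rho.toSetoid)
          ((rho_iff (mem γ) hx (hq γ) hγ).2 rfl)⟩
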